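/- Let $(\mathcal A,\varphi)$ be a $*$-noncommutative probability space, i.e. $\mathcal A$ is a unital complex $*$-algebra and $\varphi\colon\mathcal A\to\mathbb C$ is a linear functional with $\varphi(1)=1$ and $\varphi(x^*)=\overline{\varphi(x)}$, which is positive and faithful: $\varphi(x^*x)\ge 0$ for all $x$, with equality only for $x=0$. Let $a_1,b_1,a_2,b_2\in\mathcal A$ be self-adjoint and let the two-faced pairs $(a_1,b_1)$ and $(a_2,b_2)$ (left variables $a_k$, right variables $b_k$) be bi-free with respect to $\varphi$ in the sense of Voiculescu: there are complex vector spaces $\mathcal X_k=\mathbb C\xi_k\oplus\ker\psi_k$ with state vectors, $\psi_k(\xi_k)=1$, and linear operators $T_k,S_k$ on $\mathcal X_k$ ($k=1,2$), such that $a_1,a_2,b_1,b_2$ have with respect to $\varphi$ the same joint moments as $\lambda_1(T_1),\lambda_2(T_2),\rho_1(S_1),\rho_2(S_2)$ have with respect to $R\mapsto\psi(R\xi)$, where $(\mathcal X,\ker\psi,\xi)$ is the free product of the $(\mathcal X_k,\ker\psi_k,\xi_k)$ and $\lambda_k,\rho_k$ are the left and right representations of the linear operators on $\mathcal X_k$ on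 $\mathcal X$. For a set of elements write $\mathrm{alg}(\cdot)$ for the unital subalgebra of $\mathcal A$ that it generates. Suppose that the restriction of $\varphi$ to $\mathrm{alg}(a_1,a_2,b_1,b_2)$ is tracial, i.e. $\varphi(xy)=\varphi(yx)$ there, and that for each $k\in\{1,2\}$ there do not exist $\alpha_k,\beta_k\in\mathbb R$ such that $(\varphi(a_k^n),\varphi(b_k^n))=(\alpha_k^n,\beta_k^n)$ for all $n\in\mathbb N$ (neither pair is scalar in distribution). Then $\mathrm{alg}(a_1,a_2)$ and $\mathrm{alg}(b_1,b_2)$ are classically independent: every $x\in\mathrm{alg}(a_1,a_2)$ commutes with every $y\in\mathrm{alg}(b_1,b_2)$, and $\varphi(xy)=\varphi(x)\varphi(y)$. In particular, $\varphi$ decomposes as a tensor product of tracial states: the restrictions $\tau_a$ and $\tau_b$ of $\varphi$ to $\mathrm{alg}(a_1,a_2)$ and $\mathrm{alg}(b_1,b_2)$ are tracial states, and $x\otimes y\mapsto xy$ defines an isomorphism of algebras $\mathrm{alg}(a_1,a_2)\otimes\mathrm{alg}(b_1,b_2)\to\mathrm{alg}(a_1,a_2,b_1,b_2)$ which carries $\tau_a\otimes\tau_b$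 to $\varphi$. -/

import Mathlib

open scoped TensorProduct

/-! ### Noncommutative probability spaces -/

/-- `(A, φ)` is a `*`-noncommutative probability space: `φ` is a unital, Hermitian, positive and
faithful linear functional on the unital complex `*`-algebra `A`. -/
structure IsStarProbSpace {A : Type*} [Ring A] [Algebra ℂ A] [StarRing A] [StarModule ℂ A]
    (φ : A →ₗ[ℂ] ℂ) : Prop where
  map_one : φ 1 = 1
  map_star : ∀ x, φ (star x) = star (φ x)
  nonneg : ∀ x, 0 ≤ (φ (star x * x)).re ∧ (φ (star x * x)).im = 0
  faithful : ∀ x, φ (star x * x) = 0 → x = 0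

/-- `φ` is tracial on the subalgebra `S`. -/
def IsTracialOn {A : Type*} [Ring A] [Algebra ℂ A] (φ : A →ₗ[ℂ] ℂ) (S : Subalgebra ℂ A) : Prop :=
  ∀ x ∈ S, ∀ y ∈ S, φ (x * y) = φ (y * x)

/-- Classical (tensor) independence of two subalgebras: they commute elementwise and
`φ (x y) = φ x φ y` for `x` in the first and `y` in the second. -/
def ClassicallyIndependent {A : Type*} [Ring A] [Algebra ℂ A] (φ : A →ₗ[ℂ] ℂ)
    (S₁ S₂ : Subalgebra ℂ A) : Prop :=
  ∀ x ∈ S₁, ∀ y ∈ S₂, Commute x y ∧ φ (x * y) = φ x * φ y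

/-- The restriction of the functional `φ` to a subalgebra. -/
def restrictTo {A : Type*} [Ring A] [Algebra ℂ A] (φ : A →ₗ[ℂ] ℂ) (S : Subalgebra ℂ A) :
    S →ₗ[ℂ] ℂ :=
  φ.comp S.val.toLinearMap

/-- `τ` is a tracial state on `S`: unital, positive and tracial. -/
structure IsTracialState {A : Type*} [Ring A] [Algebra ℂ A] [StarRing A]
    (S : Subalgebra ℂ A) (τ : S →ₗ[ℂ] ℂ) : Prop where
  map_one : τ 1 = 1
  nonneg : ∀ x z : S, (z : A) = star (x : A) * (x : A) → 0 ≤ (τ z).re ∧ (τ z).im = 0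
  tracial : ∀ x y : S, τ (x * y) = τ (y * x)

/-! ### The free product of vector spaces with state vectors -/

universe u

/-- A complex vector space `X = ℂ ξ ⊕ ker ψ` with a distinguished state vector `ξ`,
`ψ ξ = 1`. -/
structure PointedSpace where
  X : Type u
  [grp : AddCommGroup X]
  [mod : Module ℂ X]
  ξ : X
  ψ : X →ₗ[ℂ] ℂ
  ψ_ξ : ψ ξ = 1

attribute [instance] PointedSpace.grp PointedSpace.mod

namespace PointedSpace

/-- The projection `x ↦ x - ψ(x) ξ` of `X` onto `ker ψ` along `ξ`. -/
def proj (P : PointedSpace.{u}) : P.X →ₗ[ℂ] LinearMap.ker P.ψ :=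
  LinearMap.codRestrict (LinearMap.ker P.ψ) (LinearMap.id - P.ψ.smulRight P.ξ) (by
    intro x
    simp [P.ψ_ξ])

end PointedSpace

namespace BiFree

variable (P : Fin 2 → PointedSpace.{u})

/-- The direct sum `ker ψ₁ ⊕ ker ψ₂`. -/
abbrev Letters : Type u := (j : Fin 2) → LinearMap.ker (P j).ψ

/-- The tensor algebra of `ker ψ₁ ⊕ ker ψ₂`, that is the direct sum of all
`ker ψ_{j₁} ⊗ ⋯ ⊗ ker ψ_{jₙ}`, `n ≥ 0`. -/
abbrev Fock : Type u := TensorAlgebra ℂ (Letters P)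

variable {P}

/-- The one-letter word `y`, for `y ∈ ker ψ_j`. -/
noncomputable def letter (j : Fin 2) : LinearMap.ker (P j).ψ →ₗ[ℂ] Fock P :=
  (TensorAlgebra.ι ℂ).comp (LinearMap.single ℂ (fun j => LinearMap.ker (P j).ψ) j)

/-- The elementary tensor `y₁ ⊗ ⋯ ⊗ yₙ` of a list of letters. -/
noncomputable def word (l : List (Σ j : Fin 2, LinearMap.ker (P j).ψ)) : Fock P :=
  (l.map fun p => letter p.1 p.2).prod

variable (P) in
/-- The free product `(X₁, ξ₁) * (X₂, ξ₂)`: the direct sum of `ℂ ξ` (`n = 0`, with `ξ = 1`) and of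
all `ker ψ_{j₁} ⊗ ⋯ ⊗ ker ψ_{jₙ}` with `n ≥ 1` and `j₁ ≠ j₂ ≠ ⋯ ≠ jₙ`. -/
def FreeProd : Submodule ℂ (Fock P) :=
  Submodule.span ℂ {w | ∃ l : List (Σ j : Fin 2, LinearMap.ker (P j).ψ),
    l.IsChain (fun p q => p.1 ≠ q.1) ∧ w = word l}

variable (P) in
/-- The state vector `ξ` of the free product (the empty word). -/
noncomputable def vacuum : FreeProd P :=
  ⟨1, Submodule.subset_span ⟨[], List.IsChain.nil, by simp [word]⟩⟩

variable (P) in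
/-- The functional `ψ` of the free product: it is `1` at `ξ` and vanishes on words of positive
length. -/
noncomputable def vacFunctional : FreeProd P →ₗ[ℂ] ℂ :=
  (TensorAlgebra.algebraMapInv (R := ℂ) (M := Letters P)).toLinearMap.comp (FreeProd P).subtype

/-- The embedding `x ↦ ψ_j(x) ξ + (x - ψ_j(x) ξ_j)` of `X_j = ℂ ξ_j ⊕ ker ψ_j`, which identifies
`ξ_j` with `ξ`. -/
noncomputable def embed (j : Fin 2) : (P j).X →ₗ[ℂ] Fock P :=
  (Algebra.linearMap ℂ (Fock P)).comp (P j).ψ + (letter j).comp (P j).proj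

/-- One step of `splitLeft`: `(u, _) ↦ (y u, y ⊗ u)`. -/
noncomputable def stepLeft : Letters P →ₗ[ℂ] Module.End ℂ (Fock P × (Letters P ⊗[ℂ] Fock P)) :=
  LinearMap.mk₂ ℂ (fun y q => (TensorAlgebra.ι ℂ y * q.1, y ⊗ₜ[ℂ] q.1))
    (by intros; simp [add_mul, TensorProduct.add_tmul])
    (by intros; simp [TensorProduct.smul_tmul'])
    (by intros; simp [mul_add, TensorProduct.tmul_add])
    (by intros; simp)

/-- Splitting off the first letter: `1 ↦ 0` and `y w ↦ y ⊗ w`. -/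
noncomputable def splitLeft : Fock P →ₗ[ℂ] Letters P ⊗[ℂ] Fock P :=
  (LinearMap.snd ℂ _ _).comp
    ((LinearMap.applyₗ ((1 : Fock P), (0 : Letters P ⊗[ℂ] Fock P))).comp
      (TensorAlgebra.lift ℂ (stepLeft (P := P))).toLinearMap)

/-- One step of `splitRight`: `(u, _) ↦ (u y, u ⊗ y)`. -/
noncomputable def stepRight : Letters P →ₗ[ℂ] Module.End ℂ (Fock P × (Fock P ⊗[ℂ] Letters P)) :=
  LinearMap.mk₂ ℂ (fun y q => (q.1 * TensorAlgebra.ι ℂ y, q.1 ⊗ₜ[ℂ] y))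
    (by intros; simp [mul_add, TensorProduct.tmul_add])
    (by intros; simp)
    (by intros; simp [add_mul, TensorProduct.add_tmul])
    (by intros; simp [TensorProduct.smul_tmul'])

/-- Splitting off the last letter: `1 ↦ 0` and `w y ↦ w ⊗ y`. -/
noncomputable def splitRight : Fock P →ₗ[ℂ] Fock P ⊗[ℂ] Letters P :=
  (LinearMap.snd ℂ _ _).comp
    ((LinearMap.applyₗ ((1 : Fock P), (0 : Fock P ⊗[ℂ] Letters P))).comp
      ((MulOpposite.opLinearEquiv ℂ).symm.toLinearMap.comp
        (TensorAlgebra.lift ℂ ((MulOpposite.opLinearEquiv ℂ).toLinearMap.comp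
          (stepRight (P := P)))).toLinearMap))

theorem stepLeft_apply (y : Letters P) (q : Fock P × (Letters P ⊗[ℂ] Fock P)) :
    stepLeft y q = (TensorAlgebra.ι ℂ y * q.1, y ⊗ₜ[ℂ] q.1) := rfl

theorem stepRight_apply (y : Letters P) (q : Fock P × (Fock P ⊗[ℂ] Letters P)) :
    stepRight y q = (q.1 * TensorAlgebra.ι ℂ y, q.1 ⊗ₜ[ℂ] y) := rfl

theorem splitLeft_one : splitLeft (1 : Fock P) = 0 := by
  simp [splitLeft]

theorem splitRight_one : splitRight (1 : Fock P) = 0 := by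
  simp [splitRight]

theorem lift_stepLeft_fst (w : Fock P) (q : Fock P × (Letters P ⊗[ℂ] Fock P)) :
    (TensorAlgebra.lift ℂ (stepLeft (P := P)) w q).1 = w * q.1 := by
  induction w using TensorAlgebra.induction generalizing q with
  | algebraMap r => simp [Algebra.algebraMap_eq_smul_one]
  | ι x => simp [stepLeft_apply]
  | mul a b ha hb => simp [ha, hb, mul_assoc]
  | add a b ha hb => simp [ha, hb, add_mul]

theorem splitLeft_mul (y : Letters P) (w : Fock P) :
    splitLeft (TensorAlgebra.ι ℂ y * w) = y ⊗ₜ[ℂ] w := by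
  have h := lift_stepLeft_fst w ((1 : Fock P), (0 : Letters P ⊗[ℂ] Fock P))
  simp only [mul_one] at h
  simp [splitLeft, stepLeft_apply, h]

theorem lift_stepRight_fst (w : Fock P) (q : Fock P × (Fock P ⊗[ℂ] Letters P)) :
    ((TensorAlgebra.lift ℂ ((MulOpposite.opLinearEquiv ℂ).toLinearMap.comp
      (stepRight (P := P))) w).unop q).1 = q.1 * w := by
  induction w using TensorAlgebra.induction generalizing q with
  | algebraMap r => simp [Algebra.algebraMap_eq_smul_one]
  | ι x => simp [stepRight_apply]
  | mul a b ha hb => simp [ha, hb, mul_assoc]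
  | add a b ha hb => simp [ha, hb, mul_add]

theorem splitRight_mul (w : Fock P) (y : Letters P) :
    splitRight (w * TensorAlgebra.ι ℂ y) = w ⊗ₜ[ℂ] y := by
  have h := lift_stepRight_fst w ((1 : Fock P), (0 : Fock P ⊗[ℂ] Letters P))
  simp only [one_mul] at h
  simp [splitRight, stepRight_apply, h]

/-- The part of a letter that lies in the summands other than `ker ψ_j`. -/
noncomputable def others (j : Fin 2) : Letters P →ₗ[ℂ] Letters P :=
  LinearMap.id - (LinearMap.single ℂ (fun j => LinearMap.ker (P j).ψ) j).comp (LinearMap.proj j)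

/-- The action of `T ∈ L(X_j)` from the left. With `X_j` embedded by `embed j`:
`ξ ↦ Tξ_j`; `y w ↦ (T y) w` if `y ∈ ker ψ_j`; `y w ↦ (T ξ_j) y w` if `y ∈ ker ψ_i`, `i ≠ j`. -/
noncomputable def leftAux (j : Fin 2) (T : Module.End ℂ (P j).X) : Module.End ℂ (Fock P) :=
  (TensorAlgebra.algebraMapInv (R := ℂ) (M := Letters P)).toLinearMap.smulRight
      (embed j (T (P j).ξ))
    + (TensorProduct.lift
        ((LinearMap.mul ℂ (Fock P)).comp
          ((embed j).comp (T.comp ((LinearMap.ker (P j).ψ).subtype.comp (LinearMap.proj j)))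
            + (LinearMap.mulLeft ℂ (embed j (T (P j).ξ))).comp
                ((TensorAlgebra.ι ℂ).comp (others j))))).comp splitLeft

/-- The action of `T ∈ L(X_j)` from the right. With `X_j` embedded by `embed j`:
`ξ ↦ Tξ_j`; `w y ↦ w (T y)` if `y ∈ ker ψ_j`; `w y ↦ w y (T ξ_j)` if `y ∈ ker ψ_i`, `i ≠ j`. -/
noncomputable def rightAux (j : Fin 2) (T : Module.End ℂ (P j).X) : Module.End ℂ (Fock P) :=
  (TensorAlgebra.algebraMapInv (R := ℂ) (M := Letters P)).toLinearMap.smulRight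
      (embed j (T (P j).ξ))
    + (TensorProduct.lift
        ((LinearMap.mul ℂ (Fock P)).compl₂
          ((embed j).comp (T.comp ((LinearMap.ker (P j).ψ).subtype.comp (LinearMap.proj j)))
            + (LinearMap.mulRight ℂ (embed j (T (P j).ξ))).comp
                ((TensorAlgebra.ι ℂ).comp (others j))))).comp splitRight

theorem leftAux_one (j : Fin 2) (T : Module.End ℂ (P j).X) :
    leftAux j T 1 = embed j (T (P j).ξ) := by
  simp [leftAux, splitLeft_one]

theorem rightAux_one (j : Fin 2) (T : Module.End ℂ (P j).X) :
    rightAux j T 1 = embed j (T (P j).ξ) := by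
  simp [rightAux, splitRight_one]

theorem leftAux_same (j : Fin 2) (T : Module.End ℂ (P j).X) (y : LinearMap.ker (P j).ψ)
    (w : Fock P) : leftAux j T (letter j y * w) = embed j (T y) * w := by
  simp [leftAux, letter, splitLeft_mul, others, TensorAlgebra.algebraMapInv]

theorem rightAux_same (j : Fin 2) (T : Module.End ℂ (P j).X) (y : LinearMap.ker (P j).ψ)
    (w : Fock P) : rightAux j T (w * letter j y) = w * embed j (T y) := by
  simp [rightAux, letter, splitRight_mul, others, TensorAlgebra.algebraMapInv]

theorem leftAux_of_ne {i j : Fin 2} (h : i ≠ j) (T : Module.End ℂ (P j).X)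
    (y : LinearMap.ker (P i).ψ) (w : Fock P) :
    leftAux j T (letter i y * w) = embed j (T (P j).ξ) * (letter i y * w) := by
  simp [leftAux, letter, splitLeft_mul, others, TensorAlgebra.algebraMapInv, h.symm, mul_assoc]

theorem rightAux_of_ne {i j : Fin 2} (h : i ≠ j) (T : Module.End ℂ (P j).X)
    (y : LinearMap.ker (P i).ψ) (w : Fock P) :
    rightAux j T (w * letter i y) = (w * letter i y) * embed j (T (P j).ξ) := by
  simp [rightAux, letter, splitRight_mul, others, TensorAlgebra.algebraMapInv, h.symm, mul_assoc]

theorem word_mem {l : List (Σ j : Fin 2, LinearMap.ker (P j).ψ)}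
    (h : l.IsChain (fun p q => p.1 ≠ q.1)) : word l ∈ FreeProd P :=
  Submodule.subset_span ⟨l, h, rfl⟩

theorem embed_mul_mem (j : Fin 2) (x : (P j).X) {l : List (Σ j : Fin 2, LinearMap.ker (P j).ψ)}
    (h : ∀ y, List.IsChain (fun p q => p.1 ≠ q.1) (⟨j, y⟩ :: l)) :
    embed j x * word l ∈ FreeProd P := by
  have h1 : embed j x * word l = (P j).ψ x • word l + word (⟨j, (P j).proj x⟩ :: l) := by
    simp [embed, word, add_mul, Algebra.smul_def]
  rw [h1]
  exact add_mem (Submodule.smul_mem _ _ (word_mem (h 0).tail)) (word_mem (h _))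

theorem mul_embed_mem (j : Fin 2) (x : (P j).X) {l : List (Σ j : Fin 2, LinearMap.ker (P j).ψ)}
    (h : ∀ y, List.IsChain (fun p q => p.1 ≠ q.1) (l ++ [⟨j, y⟩])) :
    word l * embed j x ∈ FreeProd P := by
  have h1 : word l * embed j x = (P j).ψ x • word l + word (l ++ [⟨j, (P j).proj x⟩]) := by
    simp [embed, word, mul_add, Algebra.smul_def, Algebra.commutes]
  rw [h1]
  exact add_mem (Submodule.smul_mem _ _ (word_mem (h 0).left_of_append)) (word_mem (h _))

theorem leftAux_mem (j : Fin 2) (T : Module.End ℂ (P j).X) :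
    ∀ w ∈ FreeProd P, leftAux j T w ∈ FreeProd P := by
  intro w hw
  refine Submodule.span_induction (p := fun w _ => leftAux j T w ∈ FreeProd P)
    ?_ (by simp) (fun x y _ _ hx hy => by rw [map_add]; exact add_mem hx hy)
    (fun c x _ hx => by rw [map_smul]; exact Submodule.smul_mem _ _ hx) hw
  rintro _ ⟨l, hl, rfl⟩
  rcases l with _ | ⟨⟨i, y⟩, l⟩
  · have := embed_mul_mem j (T (P j).ξ) (l := []) (by simp)
    simpa [word, leftAux_one] using this
  · have hc : word (⟨i, y⟩ :: l) = letter i y * word l := by simp [word]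
    by_cases h : i = j
    · subst h
      rw [hc, leftAux_same]
      refine embed_mul_mem _ _ fun z => ?_
      rw [List.isChain_cons] at hl ⊢
      exact hl
    · rw [hc, leftAux_of_ne h, ← hc]
      refine embed_mul_mem _ _ fun z => ?_
      rw [List.isChain_cons_cons]
      exact ⟨Ne.symm h, hl⟩

theorem rightAux_mem (j : Fin 2) (T : Module.End ℂ (P j).X) :
    ∀ w ∈ FreeProd P, rightAux j T w ∈ FreeProd P := by
  intro w hw
  refine Submodule.span_induction (p := fun w _ => rightAux j T w ∈ FreeProd P)
    ?_ (by simp) (fun x y _ _ hx hy => by rw [map_add]; exact add_mem hx hy)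
    (fun c x _ hx => by rw [map_smul]; exact Submodule.smul_mem _ _ hx) hw
  rintro _ ⟨l, hl, rfl⟩
  rcases List.eq_nil_or_concat l with rfl | ⟨l, ⟨i, y⟩, rfl⟩
  · have := mul_embed_mem j (T (P j).ξ) (l := []) (by simp)
    simpa [word, rightAux_one] using this
  · rw [List.concat_eq_append] at hl ⊢
    have hc : word (l ++ [⟨i, y⟩]) = word l * letter i y := by simp [word]
    by_cases h : i = j
    · subst h
      rw [hc, rightAux_same]
      refine mul_embed_mem _ _ fun z => ?_
      rw [List.isChain_append] at hl ⊢
      simpa using hl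
    · rw [hc, rightAux_of_ne h, ← hc]
      refine mul_embed_mem _ _ fun z => ?_
      rw [List.isChain_append]
      refine ⟨hl, by simp, ?_⟩
      simpa using h

/-- The left representation `λ_j : L(X_j) → L(X)` on the free product. -/
noncomputable def leftRep (j : Fin 2) (T : Module.End ℂ (P j).X) : Module.End ℂ (FreeProd P) :=
  (leftAux j T).restrict (leftAux_mem j T)

/-- The right representation `ρ_j : L(X_j) → L(X)` on the free product. -/
noncomputable def rightRep (j : Fin 2) (T : Module.End ℂ (P j).X) : Module.End ℂ (FreeProd P) :=
  (rightAux j T).restrict (rightAux_mem j T)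

end BiFree

/-- The pairs `(a 0, b 0)`, `(a 1, b 1)` (`a j` the left and `b j` the right variable) are bi-free
with respect to `φ`: for some vector spaces with state vectors `X_j` and operators `T j`, `S j` on
`X_j`, the family `a 0, a 1, b 0, b 1` has under `φ` the same joint moments as
`λ_0(T 0), λ_1(T 1), ρ_0(S 0), ρ_1(S 1)` on the free product have under `R ↦ ψ(R ξ)`. -/
def IsBiFree {A : Type u} [Ring A] [Algebra ℂ A] (φ : A →ₗ[ℂ] ℂ) (a b : Fin 2 → A) : Prop :=
  ∃ (P : Fin 2 → PointedSpace.{u}) (T S : (j : Fin 2) → Module.End ℂ (P j).X),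
    ∀ l : List (Fin 2 ⊕ Fin 2),
      φ (l.map (Sum.elim a b)).prod =
        BiFree.vacFunctional P
          ((l.map (Sum.elim (fun j => BiFree.leftRep j (T j))
            (fun j => BiFree.rightRep j (S j)))).prod (BiFree.vacuum P))

/-! Bi-freeness supplies operators on the free product whose moments at the vacuum `ξ` are those of
the given elements. Every operator preserving the free product is computed here on the whole tensor
algebra, where words multiply freely. An element `x` of `A` is paired with an operator `X` over it,
so that `φ x` is the vacuum coefficient of `X ξ`. By faithfulness of `φ`, `X ξ = 0` forces `x = 0`,
since `φ (star x * x)` is the vacuum coefficient of `Y X ξ` for any `Y` over `star x`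
(`HasModel.eq_zero`).

Commutation. If `i ≠ j`, both products of `a i` and `b j` carry `ξ` to the same vector, so they are
equal. For `a k` and `b k`, a letter from the other space separates the left action from the right
one, so the commutator `c` satisfies `c * x = 0` for each centered polynomial `x` in `a i` or in `b
i`, `i ≠ k`. As `x * x - φ (x * x)` is again centered, `φ (x * x) • c = 0`. The other pair is not
scalar, so some `x` has `φ (x * x) ≠ 0`, and `c = 0`.

Factorization. For centered `x` in `alg(a k)` and `y` in `alg(b k)`, take a centered `u` in the
other pair with `φ (u * u) ≠ 0`, say in `alg(a i)`. Bi-freeness gives `φ (u * x * u * y) = 0`,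
whereas traciality and commutation turn this moment into `φ (u * u * x * y) = φ (u * u) * φ (x *
y)`. Hence `φ (x * y) = 0` (`HasModel.apply_mul_eq_zero`). In a product of alternating centered
words, one in the `a`s and one in the `b`s, only the two last factors can interact, so the mixed
moments vanish and `φ` factorizes (`HasModel.apply_mul`). Faithfulness then makes the multiplication
map of the tensor product injective. -/

namespace BiFree

/-! ### Left and right operators acting on words -/

section Model

variable {P : Fin 2 → PointedSpace.{u}}

theorem embed_apply (j : Fin 2) (x : (P j).X) :
    embed j x = algebraMap ℂ (Fock P) ((P j).ψ x) + letter j ((P j).proj x) := rfl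

theorem coe_proj (Q : PointedSpace.{u}) (x : Q.X) : (Q.proj x : Q.X) = x - Q.ψ x • Q.ξ := rfl

theorem proj_ξ (Q : PointedSpace.{u}) : Q.proj Q.ξ = 0 :=
  Subtype.ext (by simp [coe_proj, Q.ψ_ξ])

theorem embed_ξ (j : Fin 2) : embed (P := P) j (P j).ξ = 1 := by
  simp [embed_apply, proj_ξ, (P j).ψ_ξ]

theorem embed_of_mem_ker {j : Fin 2} {x : (P j).X} (hx : (P j).ψ x = 0) :
    embed (P := P) j x = letter j ((P j).proj x) := by
  simp [embed_apply, hx]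

variable (P) in
/-- The coefficient of the empty word. -/
noncomputable def counit : Fock P →ₐ[ℂ] ℂ := TensorAlgebra.algebraMapInv

theorem counit_letter (j : Fin 2) (y : LinearMap.ker (P j).ψ) : counit P (letter j y) = 0 := by
  simp [counit, letter, TensorAlgebra.algebraMapInv]

theorem counit_embed (j : Fin 2) (x : (P j).X) : counit P (embed j x) = (P j).ψ x := by
  simp [embed_apply, counit_letter]

theorem word_cons (q : Σ j : Fin 2, LinearMap.ker (P j).ψ)
    (l : List (Σ j : Fin 2, LinearMap.ker (P j).ψ)) :
    word (q :: l) = letter q.1 q.2 * word l := by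
  simp [word]

theorem word_append (l m : List (Σ j : Fin 2, LinearMap.ker (P j).ψ)) :
    word (l ++ m) = word l * word m := by
  simp [word]

theorem counit_word {l : List (Σ j : Fin 2, LinearMap.ker (P j).ψ)} (hl : l ≠ []) :
    counit P (word l) = 0 := by
  obtain ⟨q, l, rfl⟩ := List.exists_cons_of_ne_nil hl
  simp [word_cons, counit_letter]

/-- `w` is the empty word or begins with a letter that is not in `ker ψ_j`. -/
def AvoidsLeft (j : Fin 2) (w : Fock P) : Prop :=
  w = 1 ∨ ∃ i, i ≠ j ∧ ∃ (y : LinearMap.ker (P i).ψ) (w' : Fock P), w = letter i y * w'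

/-- `w` is the empty word or ends with a letter that is not in `ker ψ_j`. -/
def AvoidsRight (j : Fin 2) (w : Fock P) : Prop :=
  w = 1 ∨ ∃ i, i ≠ j ∧ ∃ (y : LinearMap.ker (P i).ψ) (w' : Fock P), w = w' * letter i y

theorem avoidsLeft_letter_mul {i j : Fin 2} (h : i ≠ j) (y : LinearMap.ker (P i).ψ) (w : Fock P) :
    AvoidsLeft j (letter i y * w) := .inr ⟨i, h, y, w, rfl⟩

theorem avoidsRight_mul_letter {i j : Fin 2} (h : i ≠ j) (y : LinearMap.ker (P i).ψ) (w : Fock P) :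
    AvoidsRight j (w * letter i y) := .inr ⟨i, h, y, w, rfl⟩

theorem avoidsLeft_word_mul {j : Fin 2} {l : List (Σ j : Fin 2, LinearMap.ker (P j).ψ)}
    (hl : ∀ q ∈ l.head?, q.1 ≠ j) {w : Fock P} (hw : l = [] → AvoidsLeft j w) :
    AvoidsLeft j (word l * w) := by
  rcases l with _ | ⟨q, l⟩
  · simpa [word] using hw rfl
  · rw [word_cons, mul_assoc]
    exact avoidsLeft_letter_mul (hl q rfl) _ _

theorem leftAux_of_avoidsLeft {j : Fin 2} (T : Module.End ℂ (P j).X) {w : Fock P}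
    (hw : AvoidsLeft j w) : leftAux j T w = embed j (T (P j).ξ) * w := by
  rcases hw with rfl | ⟨i, h, y, w, rfl⟩
  · rw [leftAux_one, mul_one]
  · exact leftAux_of_ne h T y w

theorem rightAux_of_avoidsRight {j : Fin 2} (T : Module.End ℂ (P j).X) {w : Fock P}
    (hw : AvoidsRight j w) : rightAux j T w = w * embed j (T (P j).ξ) := by
  rcases hw with rfl | ⟨i, h, y, w, rfl⟩
  · rw [rightAux_one, one_mul]
  · exact rightAux_of_ne h T y w

theorem map_eq_proj_add (Q : PointedSpace.{u}) (T : Module.End ℂ Q.X) (x : Q.X) :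
    T x = Q.ψ x • T Q.ξ + T (Q.proj x) := by
  simp [coe_proj]

/-- On `X_j ⊗ w` the operator acts as `T ⊗ 1`. The condition on `w` serves the component along
`ξ_j`, which leaves `w` bare: there `T` has to attach a new letter and not alter one of `w`. -/
theorem leftAux_embed_mul {j : Fin 2} (T : Module.End ℂ (P j).X) (x : (P j).X) {w : Fock P}
    (hw : AvoidsLeft j w) : leftAux j T (embed j x * w) = embed j (T x) * w := by
  rw [embed_apply, add_mul, ← Algebra.smul_def, map_add, map_smul, leftAux_same,
    leftAux_of_avoidsLeft T hw, map_eq_proj_add (P j) T x, map_add, map_smul, add_mul,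
    smul_mul_assoc]

theorem rightAux_mul_embed {j : Fin 2} (T : Module.End ℂ (P j).X) (x : (P j).X) {w : Fock P}
    (hw : AvoidsRight j w) : rightAux j T (w * embed j x) = w * embed j (T x) := by
  rw [embed_apply, mul_add, ← Algebra.commutes, ← Algebra.smul_def, map_add, map_smul,
    rightAux_same, rightAux_of_avoidsRight T hw, map_eq_proj_add (P j) T x, map_add, map_smul,
    mul_add, mul_smul_comm]

/-- Transfers the action of `T` to `p(T)`, so that polynomials in the variables can be treated like
the variables themselves. -/
theorem aeval_intertwine {V W : Type*} [AddCommGroup V] [Module ℂ V] [AddCommGroup W] [Module ℂ W]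
    {T : Module.End ℂ V} {L : Module.End ℂ W} {f : V →ₗ[ℂ] W} (h : ∀ x, L (f x) = f (T x))
    (p : Polynomial ℂ) (x : V) :
    Polynomial.aeval L p (f x) = f (Polynomial.aeval T p x) := by
  induction p using Polynomial.induction_on' with
  | add p q hp hq => simp [hp, hq]
  | monomial n c =>
    have : ∀ n : ℕ, (L ^ n) (f x) = f ((T ^ n) x) := by
      intro n
      induction n with
      | zero => simp
      | succ n ih => rw [pow_succ', pow_succ', Module.End.mul_apply, ih, h, Module.End.mul_apply]
    simp [Polynomial.aeval_monomial, Algebra.algebraMap_eq_smul_one, this]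

theorem aeval_leftAux_embed_mul {j : Fin 2} (T : Module.End ℂ (P j).X) (p : Polynomial ℂ)
    (x : (P j).X) {w : Fock P} (hw : AvoidsLeft j w) :
    Polynomial.aeval (leftAux j T) p (embed j x * w) = embed j (Polynomial.aeval T p x) * w :=
  aeval_intertwine (f := (LinearMap.mulRight ℂ w).comp (embed j))
    (fun x => leftAux_embed_mul T x hw) p x

theorem aeval_rightAux_mul_embed {j : Fin 2} (T : Module.End ℂ (P j).X) (p : Polynomial ℂ)
    (x : (P j).X) {w : Fock P} (hw : AvoidsRight j w) :
    Polynomial.aeval (rightAux j T) p (w * embed j x) = w * embed j (Polynomial.aeval T p x) :=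
  aeval_intertwine (f := (LinearMap.mulLeft ℂ w).comp (embed j))
    (fun x => rightAux_mul_embed T x hw) p x

theorem aeval_leftAux_of_avoidsLeft {j : Fin 2} (T : Module.End ℂ (P j).X) (p : Polynomial ℂ)
    {w : Fock P} (hw : AvoidsLeft j w) :
    Polynomial.aeval (leftAux j T) p w = embed j (Polynomial.aeval T p (P j).ξ) * w := by
  simpa [embed_ξ] using aeval_leftAux_embed_mul T p (P j).ξ hw

theorem aeval_rightAux_of_avoidsRight {j : Fin 2} (T : Module.End ℂ (P j).X) (p : Polynomial ℂ)
    {w : Fock P} (hw : AvoidsRight j w) :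
    Polynomial.aeval (rightAux j T) p w = w * embed j (Polynomial.aeval T p (P j).ξ) := by
  simpa [embed_ξ] using aeval_rightAux_mul_embed T p (P j).ξ hw

theorem aeval_leftAux_one {j : Fin 2} (T : Module.End ℂ (P j).X) (p : Polynomial ℂ) :
    Polynomial.aeval (leftAux j T) p 1 = embed j (Polynomial.aeval T p (P j).ξ) := by
  simpa using aeval_leftAux_of_avoidsLeft T p (.inl rfl)

theorem aeval_rightAux_one {j : Fin 2} (T : Module.End ℂ (P j).X) (p : Polynomial ℂ) :
    Polynomial.aeval (rightAux j T) p 1 = embed j (Polynomial.aeval T p (P j).ξ) := by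
  simpa using aeval_rightAux_of_avoidsRight T p (.inl rfl)

theorem aeval_leftAux_embed {j : Fin 2} (T : Module.End ℂ (P j).X) (p : Polynomial ℂ)
    (x : (P j).X) :
    Polynomial.aeval (leftAux j T) p (embed j x) = embed j (Polynomial.aeval T p x) := by
  simpa using aeval_leftAux_embed_mul T p x (.inl rfl)

theorem aeval_leftAux_embed_of_ne {i j : Fin 2} (h : i ≠ j) (T : Module.End ℂ (P j).X)
    (p : Polynomial ℂ) (x : (P i).X) :
    Polynomial.aeval (leftAux j T) p (embed i x) =
      embed j (Polynomial.aeval T p (P j).ξ) * embed i x := by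
  have h1 := aeval_leftAux_of_avoidsLeft T p (avoidsLeft_letter_mul h ((P i).proj x) 1)
  rw [mul_one] at h1
  rw [embed_apply i x, map_add, h1, Algebra.algebraMap_eq_smul_one, map_smul, aeval_leftAux_one,
    mul_add, mul_smul_comm, mul_one]

theorem aeval_rightAux_embed_of_ne {i j : Fin 2} (h : i ≠ j) (T : Module.End ℂ (P j).X)
    (p : Polynomial ℂ) (x : (P i).X) :
    Polynomial.aeval (rightAux j T) p (embed i x) =
      embed i x * embed j (Polynomial.aeval T p (P j).ξ) := by
  have h1 := aeval_rightAux_of_avoidsRight T p (avoidsRight_mul_letter h ((P i).proj x) 1)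
  rw [one_mul] at h1
  rw [embed_apply i x, map_add, h1, Algebra.algebraMap_eq_smul_one, map_smul, aeval_rightAux_one,
    add_mul, smul_mul_assoc, one_mul]

/-- The foreign letter `y` stays in the middle: `T` attaches on its left, `S` on its right, and
neither sees what the other has attached. On the vacuum this fails, since there both act on the same
copy of `X_k`. -/
theorem leftAux_rightAux_letter {i k : Fin 2} (h : i ≠ k) (T S : Module.End ℂ (P k).X)
    (y : LinearMap.ker (P i).ψ) :
    leftAux k T (rightAux k S (letter i y)) = rightAux k S (leftAux k T (letter i y)) := by
  have h1 := rightAux_of_ne h S y 1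
  have h2 := leftAux_of_ne h T y 1
  rw [one_mul] at h1
  rw [mul_one] at h2
  rw [h1, h2, leftAux_of_ne h, rightAux_of_ne h, mul_assoc]

/-- The product `p₁(c_{j₁}) ⋯ pₙ(c_{jₙ})`. -/
noncomputable def polyProd {R : Type*} [Ring R] [Algebra ℂ R] (c : Fin 2 → R)
    (l : List (Fin 2 × Polynomial ℂ)) : R :=
  (l.map fun q => Polynomial.aeval (c q.1) q.2).prod

@[simp] theorem polyProd_nil {R : Type*} [Ring R] [Algebra ℂ R] (c : Fin 2 → R) :
    polyProd c [] = 1 := rfl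

@[simp] theorem polyProd_cons {R : Type*} [Ring R] [Algebra ℂ R] (c : Fin 2 → R)
    (q : Fin 2 × Polynomial ℂ) (l : List (Fin 2 × Polynomial ℂ)) :
    polyProd c (q :: l) = Polynomial.aeval (c q.1) q.2 * polyProd c l := by
  simp [polyProd]

theorem polyProd_append {R : Type*} [Ring R] [Algebra ℂ R] (c : Fin 2 → R)
    (l m : List (Fin 2 × Polynomial ℂ)) :
    polyProd c (l ++ m) = polyProd c l * polyProd c m := by
  simp [polyProd]

/-- `l` is alternating: neighbouring indices differ. -/
def Alternating (l : List (Fin 2 × Polynomial ℂ)) : Prop :=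
  l.IsChain fun p q => p.1 ≠ q.1

/-- The letter `p(T_j) ξ_j - ψ_j(p(T_j) ξ_j) ξ_j`. -/
noncomputable def polyLetter (T : (j : Fin 2) → Module.End ℂ (P j).X)
    (q : Fin 2 × Polynomial ℂ) : Σ j : Fin 2, LinearMap.ker (P j).ψ :=
  ⟨q.1, (P q.1).proj (Polynomial.aeval (T q.1) q.2 (P q.1).ξ)⟩

/-- All the factors of `l` have vanishing expectation in the state `ψ_j(· ξ_j)`. -/
def CenteredWord (T : (j : Fin 2) → Module.End ℂ (P j).X)
    (l : List (Fin 2 × Polynomial ℂ)) : Prop :=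
  ∀ q ∈ l, (P q.1).ψ (Polynomial.aeval (T q.1) q.2 (P q.1).ξ) = 0

/-- The last factor acts first, so it alone has to avoid the beginning of `w`. Each later factor
meets a letter of the other space and, being centered, attaches exactly one letter. -/
theorem polyProd_leftAux_apply (T : (j : Fin 2) → Module.End ℂ (P j).X)
    {l : List (Fin 2 × Polynomial ℂ)} (hl : Alternating l) (hc : CenteredWord T l) {w : Fock P}
    (hw : ∀ q ∈ l.getLast?, AvoidsLeft q.1 w) :
    polyProd (fun j => leftAux j (T j)) l w = word (l.map (polyLetter T)) * w := by
  induction l with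
  | nil => simp [word]
  | cons q l ih =>
    have hw' : ∀ q ∈ l.getLast?, AvoidsLeft q.1 w := by
      intro r hr
      apply hw
      rcases l with _ | ⟨s, l⟩
      · simp at hr
      · simpa [List.getLast?_cons_cons] using hr
    rw [polyProd_cons, Module.End.mul_apply,
      ih (List.IsChain.tail hl) (fun r hr => hc r (List.mem_cons_of_mem _ hr)) hw',
      aeval_leftAux_of_avoidsLeft, embed_of_mem_ker (hc q List.mem_cons_self), List.map_cons,
      word_cons, mul_assoc]
    · rfl
    · apply avoidsLeft_word_mul
      · rcases l with _ | ⟨s, l⟩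
        · simp
        · intro r hr
          have := (List.isChain_cons_cons.1 hl).1
          simp only [List.map_cons, List.head?_cons, Option.mem_some_iff] at hr
          subst hr
          exact this.symm
      · intro h
        rw [List.map_eq_nil_iff] at h
        subst h
        exact hw q (by simp)

/-- Letters are attached at the right end, the last factor first, which reverses the order. -/
theorem polyProd_rightAux_one (S : (j : Fin 2) → Module.End ℂ (P j).X)
    {l : List (Fin 2 × Polynomial ℂ)} (hl : Alternating l) (hc : CenteredWord S l) :
    polyProd (fun j => rightAux j (S j)) l 1 = word ((l.map (polyLetter S)).reverse) := by
  induction l with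
  | nil => simp [word]
  | cons q l ih =>
    rw [polyProd_cons, Module.End.mul_apply,
      ih (List.IsChain.tail hl) (fun r hr => hc r (List.mem_cons_of_mem _ hr)),
      aeval_rightAux_of_avoidsRight, embed_of_mem_ker (hc q List.mem_cons_self), List.map_cons,
      List.reverse_cons, word_append]
    · congr 1
      simp [word, polyLetter]
    · rcases l with _ | ⟨s, l⟩
      · exact .inl (by simp [word])
      · rw [List.map_cons, List.reverse_cons, word_append]
        have := (List.isChain_cons_cons.1 hl).1
        simpa [word, polyLetter] using avoidsRight_mul_letter this.symm _ _

theorem counit_polyProd_left (T : (j : Fin 2) → Module.End ℂ (P j).X)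
    {l : List (Fin 2 × Polynomial ℂ)} (hl : Alternating l) (hc : CenteredWord T l) (h : l ≠ []) :
    counit P (polyProd (fun j => leftAux j (T j)) l 1) = 0 := by
  rw [polyProd_leftAux_apply T hl hc (fun _ _ => .inl rfl), mul_one]
  exact counit_word (by simpa using h)

/-- After the right operators have acted, the leftmost letter comes from `t`, and `s` is the first
left operator to meet it. If the indices differ, the letters just accumulate. If they agree, `s`
turns that letter into `p(T) q(S) ξ_j`, which by `hst` has no component along `ξ_j` and is again a
letter. Either way the resulting word has positive length. -/
theorem counit_polyProd_left_right (T S : (j : Fin 2) → Module.End ℂ (P j).X)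
    {l r : List (Fin 2 × Polynomial ℂ)} {s t : Fin 2 × Polynomial ℂ}
    (hl : Alternating (l ++ [s])) (hlc : CenteredWord T (l ++ [s]))
    (hr : Alternating (r ++ [t])) (hrc : CenteredWord S (r ++ [t]))
    (hst : t.1 = s.1 → (P s.1).ψ (Polynomial.aeval (T s.1) s.2
      (Polynomial.aeval (S s.1) t.2 (P s.1).ξ)) = 0) :
    counit P (polyProd (fun j => leftAux j (T j)) (l ++ [s])
      (polyProd (fun j => rightAux j (S j)) (r ++ [t]) 1)) = 0 := by
  have hR : polyProd (fun j => rightAux j (S j)) (r ++ [t]) 1 =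
      letter t.1 ((P t.1).proj (Polynomial.aeval (S t.1) t.2 (P t.1).ξ)) *
        word ((r.map (polyLetter S)).reverse) := by
    rw [polyProd_rightAux_one S hr hrc]
    simp [word_cons, polyLetter]
  by_cases h : t.1 = s.1
  · obtain ⟨j, q⟩ := t
    obtain ⟨k, p⟩ := s
    obtain rfl : j = k := h
    -- Behind the letter of `t` comes that of the last factor of `r`, whose index differs from `t`'s
    -- by alternation.
    have hrev : AvoidsLeft j (word ((r.map (polyLetter S)).reverse)) := by
      rw [← mul_one (word _)]
      refine avoidsLeft_word_mul ?_ fun _ => .inl rfl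
      intro z hz
      rw [List.head?_reverse, List.getLast?_map] at hz
      obtain ⟨y, hy, rfl⟩ := Option.mem_map.1 hz
      exact (List.isChain_append.1 hr).2.2 y hy _ rfl
    have hq : (P j).ψ (Polynomial.aeval (S j) q (P j).ξ) = 0 := hrc (j, q) (by simp)
    have hp := hst rfl
    dsimp only at hp
    have h1 : Polynomial.aeval (leftAux j (T j)) p
        (letter j ((P j).proj (Polynomial.aeval (S j) q (P j).ξ)) *
          word ((r.map (polyLetter S)).reverse)) =
        letter j ((P j).proj (Polynomial.aeval (T j) p (Polynomial.aeval (S j) q (P j).ξ))) *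
          word ((r.map (polyLetter S)).reverse) := by
      have := aeval_leftAux_embed_mul (T j) p (Polynomial.aeval (S j) q (P j).ξ) hrev
      rwa [embed_of_mem_ker hq, embed_of_mem_ker hp] at this
    have hl' := List.isChain_append.1 hl
    rw [hR, polyProd_append, Module.End.mul_apply, polyProd_cons, polyProd_nil, mul_one]
    dsimp only
    rw [h1, polyProd_leftAux_apply T hl'.1 (fun z hz => hlc z (List.mem_append_left _ hz))]
    · simp [counit_letter]
    · intro z hz
      exact avoidsLeft_letter_mul (hl'.2.2 z hz _ rfl).symm _ _
  · rw [hR, polyProd_leftAux_apply T hl hlc]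
    · rw [map_mul, map_mul, counit_letter, zero_mul, mul_zero]
    · intro z hz
      simp only [List.getLast?_concat, Option.mem_some_iff] at hz
      subst hz
      exact avoidsLeft_letter_mul h _ _

end Model

end BiFree

namespace BiFree

/-! ### Transfer between the elements of `A` and the operators -/

section Joint

variable {A : Type u} [Ring A] [Algebra ℂ A] {P : Fin 2 → PointedSpace.{u}}

/-- The subalgebra of `A × L(X)` generated by the pairs `(a_k, λ_k(T_k))` and `(b_k, ρ_k(S_k))`. -/
def jointAlgebra (a b : Fin 2 → A) (T S : (j : Fin 2) → Module.End ℂ (P j).X) :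
    Subalgebra ℂ (A × Module.End ℂ (Fock P)) :=
  Algebra.adjoin ℂ (Set.range (Sum.elim (fun k => (a k, leftAux k (T k)))
    (fun k => (b k, rightAux k (S k)))))

variable {a b : Fin 2 → A} {T S : (j : Fin 2) → Module.End ℂ (P j).X}

theorem left_mem_jointAlgebra (k : Fin 2) :
    (a k, leftAux k (T k)) ∈ jointAlgebra a b T S :=
  Algebra.subset_adjoin ⟨.inl k, rfl⟩

theorem right_mem_jointAlgebra (k : Fin 2) :
    (b k, rightAux k (S k)) ∈ jointAlgebra a b T S :=
  Algebra.subset_adjoin ⟨.inr k, rfl⟩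

theorem pair_mul_mem {B : Type*} [Ring B] [Algebra ℂ B] {J : Subalgebra ℂ (A × B)} {x y : A}
    {X Y : B} (hx : (x, X) ∈ J) (hy : (y, Y) ∈ J) : (x * y, X * Y) ∈ J :=
  mul_mem hx hy

theorem aeval_pair_mem {B : Type*} [Ring B] [Algebra ℂ B] {J : Subalgebra ℂ (A × B)} {x : A} {X : B}
    (h : (x, X) ∈ J) (p : Polynomial ℂ) : (Polynomial.aeval x p, Polynomial.aeval X p) ∈ J := by
  have h1 : Polynomial.aeval (x, X) p ∈ J := 
    Algebra.adjoin_le (by simpa using h) (Polynomial.aeval_mem_adjoin_singleton ℂ (x, X))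
  rwa [Polynomial.aeval_prod_apply] at h1

theorem polyProd_pair_mem {B : Type*} [Ring B] [Algebra ℂ B] {J : Subalgebra ℂ (A × B)}
    {c : Fin 2 → A} {C : Fin 2 → B} (h : ∀ k, (c k, C k) ∈ J) (l : List (Fin 2 × Polynomial ℂ)) :
    (polyProd c l, polyProd C l) ∈ J := by
  induction l with
  | nil => exact one_mem J
  | cons q l ih => simpa using mul_mem (aeval_pair_mem (h q.1) q.2) ih

/-- Relations in `A` need not hold between the operators, so the operator over `x` is not claimed to
be unique. -/
theorem exists_mem_jointAlgebra {x : A}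
    (hx : x ∈ Algebra.adjoin ℂ (Set.range a ∪ Set.range b)) :
    ∃ X, (x, X) ∈ jointAlgebra a b T S := by
  have h : Algebra.adjoin ℂ (Set.range a ∪ Set.range b) ≤
      (jointAlgebra a b T S).map (AlgHom.fst ℂ A (Module.End ℂ (Fock P))) := by
    refine Algebra.adjoin_le ?_
    rintro _ (⟨k, rfl⟩ | ⟨k, rfl⟩)
    · exact ⟨_, left_mem_jointAlgebra k, rfl⟩
    · exact ⟨_, right_mem_jointAlgebra k, rfl⟩
  obtain ⟨⟨y, Y⟩, hY, rfl⟩ := h hx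
  exact ⟨Y, hY⟩

theorem coe_prod_rep (l : List (Fin 2 ⊕ Fin 2)) (v : FreeProd P) :
    (((l.map (Sum.elim (fun j => leftRep j (T j)) (fun j => rightRep j (S j)))).prod v :
      FreeProd P) : Fock P) =
    (l.map (Sum.elim (fun j => leftAux j (T j)) (fun j => rightAux j (S j)))).prod v := by
  induction l with
  | nil => simp
  | cons s l ih =>
    rw [List.map_cons, List.map_cons, List.prod_cons, List.prod_cons, Module.End.mul_apply,
      Module.End.mul_apply, ← ih]
    rcases s with j | j <;> rfl

/-- The operators on the free product have the same joint moments as the given elements. -/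
def HasModel (φ : A →ₗ[ℂ] ℂ) (a b : Fin 2 → A) (T S : (j : Fin 2) → Module.End ℂ (P j).X) : Prop :=
  ∀ l : List (Fin 2 ⊕ Fin 2),
    φ (l.map (Sum.elim a b)).prod =
      vacFunctional P ((l.map (Sum.elim (fun j => leftRep j (T j))
        (fun j => rightRep j (S j)))).prod (vacuum P))

variable {φ : A →ₗ[ℂ] ℂ}

theorem HasModel.apply_eq (hm : HasModel φ a b T S) {x : A} {X : Module.End ℂ (Fock P)}
    (h : (x, X) ∈ jointAlgebra a b T S) : φ x = counit P (X 1) := by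
  suffices H : ∀ z ∈ jointAlgebra a b T S, φ z.1 = counit P (z.2 1) from H _ h
  intro z hz
  rw [jointAlgebra, ← Subalgebra.mem_toSubmodule, Algebra.adjoin_eq_span] at hz
  induction hz using Submodule.span_induction with
  | zero => simp
  | add x y _ _ hx hy => simp [hx, hy]
  | smul c x _ hx => simp [hx]
  | mem z hz =>
    have : ∃ l : List (Fin 2 ⊕ Fin 2), z = ((l.map (Sum.elim a b)).prod,
        (l.map (Sum.elim (fun j => leftAux j (T j)) (fun j => rightAux j (S j)))).prod) := by
      induction hz using Submonoid.closure_induction_left with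
      | one => exact ⟨[], rfl⟩
      | mul_left x hx y _ ih =>
        obtain ⟨s, rfl⟩ := hx
        obtain ⟨l, rfl⟩ := ih
        refine ⟨s :: l, ?_⟩
        rcases s with k | k <;> simp
    obtain ⟨l, rfl⟩ := this
    have h1 := hm l
    have h2 := coe_prod_rep (T := T) (S := S) l (vacuum P)
    rw [h1]
    change counit P _ = _
    rw [Submodule.subtype_apply, h2]
    rfl

section Star

variable [StarRing A] [StarModule ℂ A]

theorem star_mem_adjoin {s : Set A} (hs : ∀ x ∈ s, IsSelfAdjoint x) {x : A}
    (hx : x ∈ Algebra.adjoin ℂ s) : star x ∈ Algebra.adjoin ℂ s := by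
  induction hx using Algebra.adjoin_induction with
  | mem x hx => rw [(hs x hx).star_eq]; exact Algebra.subset_adjoin hx
  | algebraMap r => rw [← algebraMap_star_comm]; exact Subalgebra.algebraMap_mem _ _
  | add x y _ _ hx hy => rw [star_add]; exact add_mem hx hy
  | mul x y _ _ hx hy => rw [star_mul]; exact mul_mem hy hx

/-- The adjoint is taken in `A`, as the operators have none: `star x` lies in the generated algebra,
so some `Y` lies over it, and `φ (star x * x)` is read off from `Y (X 1) = 0`. -/
theorem HasModel.eq_zero (hm : HasModel φ a b T S) (hφ : IsStarProbSpace φ)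
    (ha : ∀ k, IsSelfAdjoint (a k)) (hb : ∀ k, IsSelfAdjoint (b k))
    {x : A} {X : Module.End ℂ (Fock P)} (h : (x, X) ∈ jointAlgebra a b T S) (h0 : X 1 = 0) :
    x = 0 := by
  have hx : x ∈ Algebra.adjoin ℂ (Set.range a ∪ Set.range b) := by
    have : jointAlgebra a b T S ≤ (Algebra.adjoin ℂ (Set.range a ∪ Set.range b)).comap
        (AlgHom.fst ℂ A (Module.End ℂ (Fock P))) := by
      refine Algebra.adjoin_le ?_
      rintro _ ⟨k | k, rfl⟩
      · exact Algebra.subset_adjoin (.inl ⟨k, rfl⟩)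
      · exact Algebra.subset_adjoin (.inr ⟨k, rfl⟩)
    exact this h
  have hs : star x ∈ Algebra.adjoin ℂ (Set.range a ∪ Set.range b) := by
    refine star_mem_adjoin ?_ hx
    rintro _ (⟨k, rfl⟩ | ⟨k, rfl⟩)
    exacts [ha k, hb k]
  obtain ⟨Y, hY⟩ := exists_mem_jointAlgebra (T := T) (S := S) hs
  refine hφ.faithful x ?_
  rw [hm.apply_eq (mul_mem hY h : (star x * x, Y * X) ∈ _)]
  simp [h0]

end Star

theorem HasModel.apply_aeval_left (hm : HasModel φ a b T S) (k : Fin 2) (p : Polynomial ℂ) :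
    φ (Polynomial.aeval (a k) p) = (P k).ψ (Polynomial.aeval (T k) p (P k).ξ) := by
  rw [hm.apply_eq (aeval_pair_mem (left_mem_jointAlgebra k) p), aeval_leftAux_one, counit_embed]

theorem HasModel.apply_aeval_right (hm : HasModel φ a b T S) (k : Fin 2) (p : Polynomial ℂ) :
    φ (Polynomial.aeval (b k) p) = (P k).ψ (Polynomial.aeval (S k) p (P k).ξ) := by
  rw [hm.apply_eq (aeval_pair_mem (right_mem_jointAlgebra k) p), aeval_rightAux_one, counit_embed]

theorem HasModel.apply_aeval_left_right (hm : HasModel φ a b T S) (k : Fin 2)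
    (p q : Polynomial ℂ) :
    φ (Polynomial.aeval (a k) p * Polynomial.aeval (b k) q) =
      (P k).ψ (Polynomial.aeval (T k) p (Polynomial.aeval (S k) q (P k).ξ)) := by
  rw [hm.apply_eq (pair_mul_mem (aeval_pair_mem (left_mem_jointAlgebra k) p)
      (aeval_pair_mem (right_mem_jointAlgebra k) q)), Module.End.mul_apply,
    aeval_rightAux_one, aeval_leftAux_embed, counit_embed]

/-- The moments of `(a₁, b₁)` and `(a₂, b₂)` factorize when an element of the one is followed by
elements of the other. -/
theorem HasModel.apply_left_mul (hm : HasModel φ a b T S) {i k : Fin 2} (h : i ≠ k)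
    (u p q : Polynomial ℂ) :
    φ (Polynomial.aeval (a i) u * (Polynomial.aeval (a k) p * Polynomial.aeval (b k) q)) =
      φ (Polynomial.aeval (a i) u) * φ (Polynomial.aeval (a k) p * Polynomial.aeval (b k) q) := by
  rw [hm.apply_aeval_left_right, hm.apply_aeval_left,
    hm.apply_eq (pair_mul_mem (aeval_pair_mem (left_mem_jointAlgebra i) u)
      (pair_mul_mem (aeval_pair_mem (left_mem_jointAlgebra k) p)
      (aeval_pair_mem (right_mem_jointAlgebra k) q))), Module.End.mul_apply, Module.End.mul_apply,
    aeval_rightAux_one, aeval_leftAux_embed, aeval_leftAux_embed_of_ne h.symm, map_mul,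
    counit_embed, counit_embed]

theorem HasModel.apply_right_mul (hm : HasModel φ a b T S) {i k : Fin 2} (h : i ≠ k)
    (u p q : Polynomial ℂ) :
    φ (Polynomial.aeval (b i) u * (Polynomial.aeval (a k) p * Polynomial.aeval (b k) q)) =
      φ (Polynomial.aeval (b i) u) * φ (Polynomial.aeval (a k) p * Polynomial.aeval (b k) q) := by
  rw [hm.apply_aeval_left_right, hm.apply_aeval_right,
    hm.apply_eq (pair_mul_mem (aeval_pair_mem (right_mem_jointAlgebra i) u)
      (pair_mul_mem (aeval_pair_mem (left_mem_jointAlgebra k) p)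
      (aeval_pair_mem (right_mem_jointAlgebra k) q))), Module.End.mul_apply, Module.End.mul_apply,
    aeval_rightAux_one, aeval_leftAux_embed, aeval_rightAux_embed_of_ne h.symm, map_mul,
    counit_embed, counit_embed, mul_comm]

/-- All the factors of `l` are centered under `φ`. -/
def Centered (φ : A →ₗ[ℂ] ℂ) (c : Fin 2 → A) (l : List (Fin 2 × Polynomial ℂ)) : Prop :=
  ∀ q ∈ l, φ (Polynomial.aeval (c q.1) q.2) = 0

theorem HasModel.centeredWord_left (hm : HasModel φ a b T S) {l : List (Fin 2 × Polynomial ℂ)}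
    (h : Centered φ a l) : CenteredWord T l := fun q hq => by
  rw [← hm.apply_aeval_left, h q hq]

theorem HasModel.centeredWord_right (hm : HasModel φ a b T S) {l : List (Fin 2 × Polynomial ℂ)}
    (h : Centered φ b l) : CenteredWord S l := fun q hq => by
  rw [← hm.apply_aeval_right, h q hq]

theorem HasModel.apply_polyProd_left (hm : HasModel φ a b T S) {l : List (Fin 2 × Polynomial ℂ)}
    (hl : Alternating l) (hc : Centered φ a l) (h : l ≠ []) : φ (polyProd a l) = 0 := by
  rw [hm.apply_eq (polyProd_pair_mem left_mem_jointAlgebra l)]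
  exact counit_polyProd_left T hl (hm.centeredWord_left hc) h

theorem HasModel.apply_polyProd_left_right (hm : HasModel φ a b T S)
    {l r : List (Fin 2 × Polynomial ℂ)} {s t : Fin 2 × Polynomial ℂ}
    (hl : Alternating (l ++ [s])) (hlc : Centered φ a (l ++ [s]))
    (hr : Alternating (r ++ [t])) (hrc : Centered φ b (r ++ [t]))
    (hst : t.1 = s.1 → φ (Polynomial.aeval (a s.1) s.2 * Polynomial.aeval (b s.1) t.2) = 0) :
    φ (polyProd a (l ++ [s]) * polyProd b (r ++ [t])) = 0 := by
  rw [hm.apply_eq (pair_mul_mem (polyProd_pair_mem left_mem_jointAlgebra _)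
    (polyProd_pair_mem right_mem_jointAlgebra _))]
  exact counit_polyProd_left_right T S hl (hm.centeredWord_left hlc) hr (hm.centeredWord_right hrc)
    fun h => by rw [← hm.apply_aeval_left_right, hst h]

/-- The algebra generated by `c` is spanned by alternating products of centered elements. -/
theorem mem_span_polyProd (hφ : φ 1 = 1) (c : Fin 2 → A) {x : A}
    (hx : x ∈ Algebra.adjoin ℂ (Set.range c)) :
    x ∈ Submodule.span ℂ {x | ∃ l, Alternating l ∧ Centered φ c l ∧ x = polyProd c l} := by
  set V := Submodule.span ℂ {x | ∃ l, Alternating l ∧ Centered φ c l ∧ x = polyProd c l} with hV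
  -- Splitting `p` into `p - β` and the constant `β = φ (p(c_k))` gives two alternating centered
  -- words, one with the extra factor and one without it.
  have key : ∀ (k : Fin 2) (p : Polynomial ℂ) (l : List (Fin 2 × Polynomial ℂ)),
      (∀ p, Alternating ((k, p) :: l)) → Centered φ c l →
      Polynomial.aeval (c k) p * polyProd c l ∈ V := by
    intro k p l hl hc
    set β := φ (Polynomial.aeval (c k) p) with hβ
    have h1 : Polynomial.aeval (c k) p * polyProd c l =
        polyProd c ((k, p - Polynomial.C β) :: l) + β • polyProd c l := by
      simp [sub_mul, Algebra.smul_def]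
    rw [h1]
    refine add_mem (Submodule.subset_span ⟨_, hl _, ?_, rfl⟩)
      (Submodule.smul_mem _ _ (Submodule.subset_span ⟨_, (hl 0).tail, hc, rfl⟩))
    intro q hq
    rcases List.mem_cons.1 hq with rfl | hq
    · simp [Algebra.algebraMap_eq_smul_one, hφ, hβ]
    · exact hc q hq
  -- The new factor either merges with a first factor of the same index, giving `X * p`, which need
  -- not be centered, or is prepended to the word.
  have step : ∀ k, ∀ v ∈ V, c k * v ∈ V := by
    intro k v hv
    induction hv using Submodule.span_induction with
    | zero => simp
    | add x y _ _ hx hy => rw [mul_add]; exact add_mem hx hy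
    | smul r x _ hx => rw [mul_smul_comm]; exact Submodule.smul_mem _ _ hx
    | mem v hv =>
      obtain ⟨l, hl, hc, rfl⟩ := hv
      rcases l with _ | ⟨⟨j, p⟩, l⟩
      · simpa using key k Polynomial.X [] (fun _ => List.isChain_singleton _) hc
      · by_cases h : k = j
        · subst h
          have := key k (Polynomial.X * p) l
            (fun q => by
              have := List.isChain_cons.1 hl
              exact List.isChain_cons.2 this)
            (fun q hq => hc q (List.mem_cons_of_mem _ hq))
          simpa [mul_assoc] using this
        · simpa using key k Polynomial.X ((j, p) :: l)
            (fun q => List.isChain_cons_cons.2 ⟨h, hl⟩) hc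
  have all : ∀ y ∈ Algebra.adjoin ℂ (Set.range c), ∀ v ∈ V, y * v ∈ V := by
    intro y hy
    induction hy using Algebra.adjoin_induction with
    | mem y hy => obtain ⟨k, rfl⟩ := hy; exact step k
    | algebraMap r =>
      intro v hv
      rw [← Algebra.smul_def]
      exact Submodule.smul_mem _ _ hv
    | add x y _ _ hx hy => intro v hv; rw [add_mul]; exact add_mem (hx v hv) (hy v hv)
    | mul x y _ _ hx hy => intro v hv; rw [mul_assoc]; exact hx _ (hy v hv)
  simpa using all x hx 1 (Submodule.subset_span ⟨[], List.isChain_nil, by simp [Centered], rfl⟩)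

end Joint

end BiFree

namespace BiFree

/-! ### Commutation and factorization -/

section Independence

variable {A : Type u} [Ring A] [Algebra ℂ A] {P : Fin 2 → PointedSpace.{u}}
  {a b : Fin 2 → A} {T S : (j : Fin 2) → Module.End ℂ (P j).X} {φ : A →ₗ[ℂ] ℂ}

/-- Some polynomial in `c` is centered and has nonzero second moment. -/
def HasVariance (φ : A →ₗ[ℂ] ℂ) (c : A) : Prop :=
  ∃ p : Polynomial ℂ, φ (Polynomial.aeval c p) = 0 ∧
    φ (Polynomial.aeval c p * Polynomial.aeval c p) ≠ 0

/-- Without variance the self-adjoint element `c - φ(c)` has vanishing second moment, so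
faithfulness makes `c` a scalar, which is real because `c` is self-adjoint. -/
theorem pow_eq_of_not_hasVariance [StarRing A] [StarModule ℂ A] (hφ : IsStarProbSpace φ) {c : A}
    (hc : IsSelfAdjoint c) (h : ¬ HasVariance φ c) :
    ∃ α : ℝ, ∀ n : ℕ, φ (c ^ n) = (α : ℂ) ^ n := by
  have hre : ((φ c).re : ℂ) = φ c := by
    rw [← Complex.conj_eq_iff_re, starRingEnd_apply, ← hφ.map_star, hc.star_eq]
  have hx : IsSelfAdjoint (c - algebraMap ℂ A (φ c)) := by
    refine hc.sub ?_
    rw [IsSelfAdjoint, ← algebraMap_star_comm, ← hφ.map_star, hc.star_eq]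
  have h0 : c - algebraMap ℂ A (φ c) = 0 := by
    apply hφ.faithful
    rw [hx.star_eq]
    by_contra hne
    refine h ⟨Polynomial.X - Polynomial.C (φ c), ?_, by simpa using hne⟩
    simp [Algebra.algebraMap_eq_smul_one, hφ.map_one]
  refine ⟨(φ c).re, fun n => ?_⟩
  rw [hre]
  nth_rewrite 1 [sub_eq_zero.1 h0]
  rw [← map_pow, Algebra.algebraMap_eq_smul_one, map_smul, hφ.map_one, smul_eq_mul, mul_one]

/-- In either order the vacuum is sent to the product of `embed i (T_i ξ_i)` and `embed j (S_j
ξ_j)`. -/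
theorem HasModel.commute_of_ne [StarRing A] [StarModule ℂ A] (hm : HasModel φ a b T S)
    (hφ : IsStarProbSpace φ) (ha : ∀ k, IsSelfAdjoint (a k)) (hb : ∀ k, IsSelfAdjoint (b k))
    {i j : Fin 2} (h : i ≠ j) : Commute (a i) (b j) := by
  have hl := left_mem_jointAlgebra (a := a) (b := b) (T := T) (S := S) i
  have hr := right_mem_jointAlgebra (a := a) (b := b) (T := T) (S := S) j
  have hX := sub_mem (pair_mul_mem hl hr) (pair_mul_mem hr hl)
  rw [Prod.mk_sub_mk] at hX
  refine sub_eq_zero.1 (hm.eq_zero hφ ha hb hX ?_)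
  have h1 := aeval_leftAux_embed_of_ne h.symm (T i) Polynomial.X (S j (P j).ξ)
  have h2 := aeval_rightAux_embed_of_ne h (S j) Polynomial.X (T i (P i).ξ)
  simp only [Polynomial.aeval_X] at h1 h2
  rw [LinearMap.sub_apply, Module.End.mul_apply, Module.End.mul_apply, rightAux_one, leftAux_one,
    h1, h2, sub_self]

/-- Centering makes `X 1` a single letter of `ker ψ_i`, on which the left and right operators of
index `k` commute. -/
theorem HasModel.commutator_mul_eq_zero [StarRing A] [StarModule ℂ A] (hm : HasModel φ a b T S)
    (hφ : IsStarProbSpace φ) (ha : ∀ k, IsSelfAdjoint (a k)) (hb : ∀ k, IsSelfAdjoint (b k))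
    {i k : Fin 2} (h : i ≠ k) {x : A} {X : Module.End ℂ (Fock P)}
    (hX : (x, X) ∈ jointAlgebra a b T S) {v : (P i).X} (hv : X 1 = embed i v) (hx : φ x = 0) :
    (a k * b k - b k * a k) * x = 0 := by
  have hl := left_mem_jointAlgebra (a := a) (b := b) (T := T) (S := S) k
  have hr := right_mem_jointAlgebra (a := a) (b := b) (T := T) (S := S) k
  have hC := sub_mem (pair_mul_mem hl hr) (pair_mul_mem hr hl)
  rw [Prod.mk_sub_mk] at hC
  refine hm.eq_zero hφ ha hb (pair_mul_mem hC hX) ?_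
  have hv0 : (P i).ψ v = 0 := by rw [← counit_embed, ← hv, ← hm.apply_eq hX, hx]
  rw [Module.End.mul_apply, hv, embed_of_mem_ker hv0, LinearMap.sub_apply, Module.End.mul_apply,
    Module.End.mul_apply, leftAux_rightAux_letter h, sub_self]

/-- With `y = p(x)` centered, `y * y - φ (y * y)` is centered too. Thus `c` annihilates both, and `0
= c * y * y = φ (y * y) • c`. -/
theorem eq_zero_of_forall_mul_aeval (hφ : φ 1 = 1) {c x : A}
    (h : ∀ p : Polynomial ℂ, φ (Polynomial.aeval x p) = 0 → c * Polynomial.aeval x p = 0)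
    (hx : HasVariance φ x) : c = 0 := by
  obtain ⟨p, hp, hpp⟩ := hx
  rw [← map_mul] at hpp
  have h1 := h (p * p - Polynomial.C (φ (Polynomial.aeval x (p * p))))
    (by simp [Algebra.algebraMap_eq_smul_one, hφ])
  rw [map_sub, mul_sub, map_mul, ← mul_assoc, h p hp, zero_mul, zero_sub, neg_eq_zero,
    Polynomial.aeval_C, Algebra.algebraMap_eq_smul_one, mul_smul_comm, mul_one, ← map_mul] at h1
  exact (smul_eq_zero.1 h1).resolve_left hpp

theorem HasModel.commute_same [StarRing A] [StarModule ℂ A] (hm : HasModel φ a b T S)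
    (hφ : IsStarProbSpace φ) (ha : ∀ k, IsSelfAdjoint (a k)) (hb : ∀ k, IsSelfAdjoint (b k))
    {i k : Fin 2} (h : i ≠ k) (hv : HasVariance φ (a i) ∨ HasVariance φ (b i)) :
    Commute (a k) (b k) := by
  refine sub_eq_zero.1 ?_
  rcases hv with hv | hv
  · exact eq_zero_of_forall_mul_aeval hφ.map_one (fun p hp => hm.commutator_mul_eq_zero hφ ha hb h
      (aeval_pair_mem (left_mem_jointAlgebra i) p) (aeval_leftAux_one (T i) p) hp) hv
  · exact eq_zero_of_forall_mul_aeval hφ.map_one (fun p hp => hm.commutator_mul_eq_zero hφ ha hb h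
      (aeval_pair_mem (right_mem_jointAlgebra i) p) (aeval_rightAux_one (S i) p) hp) hv

theorem commute_aeval {x y : A} (h : Commute x y) (p q : Polynomial ℂ) :
    Commute (Polynomial.aeval x p) (Polynomial.aeval y q) := by
  have h1 : ∀ z, Commute z y → Commute z (Polynomial.aeval y q) := fun z hz =>
    Algebra.commute_of_mem_adjoin_singleton_of_commute
      (Polynomial.aeval_mem_adjoin_singleton ℂ y) hz
  exact (Algebra.commute_of_mem_adjoin_singleton_of_commute
      (Polynomial.aeval_mem_adjoin_singleton ℂ x) (h1 x h).symm).symm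

/-- Traciality enters here: a centered `u` of index `i` is placed on both sides of the factor of
index `k` on its own face. The enlarged word ends in index `i` and the other word in index `k`, so
the moment vanishes with no assumption on `φ (x * y)`. Cycling one `u` around leaves `φ (u * u) * φ
(x * y)`. -/
theorem HasModel.apply_mul_eq_zero (hm : HasModel φ a b T S)
    (hcomm : ∀ i j, Commute (a i) (b j))
    (htr : IsTracialOn φ (Algebra.adjoin ℂ (Set.range a ∪ Set.range b)))
    {i k : Fin 2} (h : i ≠ k) (hv : HasVariance φ (a i) ∨ HasVariance φ (b i))
    {p q : Polynomial ℂ} (hp : φ (Polynomial.aeval (a k) p) = 0)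
    (hq : φ (Polynomial.aeval (b k) q) = 0) :
    φ (Polynomial.aeval (a k) p * Polynomial.aeval (b k) q) = 0 := by
  have hA : ∀ j r, Polynomial.aeval (a j) r ∈ Algebra.adjoin ℂ (Set.range a ∪ Set.range b) :=
    fun j r => Algebra.adjoin_mono (by rintro _ rfl; exact .inl ⟨j, rfl⟩)
      (Polynomial.aeval_mem_adjoin_singleton ℂ (a j))
  have hB : ∀ j r, Polynomial.aeval (b j) r ∈ Algebra.adjoin ℂ (Set.range a ∪ Set.range b) :=
    fun j r => Algebra.adjoin_mono (by rintro _ rfl; exact .inr ⟨j, rfl⟩)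
      (Polynomial.aeval_mem_adjoin_singleton ℂ (b j))
  rcases hv with ⟨r, hr, hrr⟩ | ⟨r, hr, hrr⟩
  · have h0 : φ (polyProd a ([(i, r), (k, p)] ++ [(i, r)]) * polyProd b ([] ++ [(k, q)])) = 0 := by
      refine hm.apply_polyProd_left_right ?_ ?_ (List.isChain_singleton _) ?_
        (fun hki => absurd hki.symm h)
      · simp [Alternating, h, h.symm]
      · simp [Centered, hr, hp]
      · simp [Centered, hq]
    refine (mul_eq_zero.1 ?_).resolve_left hrr
    rw [← map_mul (Polynomial.aeval (a i)), ← hm.apply_left_mul h, ← h0]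
    set u := Polynomial.aeval (a i) r with hu
    set x := Polynomial.aeval (a k) p with hx
    set y := Polynomial.aeval (b k) q with hy
    have huy : Commute u y := commute_aeval (hcomm i k) r q
    have h1 := htr u (hA i r) (x * u * y) (mul_mem (mul_mem (hA k p) (hA i r)) (hB k q))
    have h2 := htr x (hA k p) (u * u * y) (mul_mem (mul_mem (hA i r) (hA i r)) (hB k q))
    have hxy : Commute x y := commute_aeval (hcomm k k) p q
    simp only [List.cons_append, List.nil_append, polyProd_cons, polyProd_nil, mul_one, map_mul,
      ← hu, ← hx, ← hy]
    calc φ (u * u * (x * y)) = φ (u * u * y * x) := by rw [hxy.eq, mul_assoc (u * u)]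
      _ = φ (x * u * y * u) := by rw [← h2, mul_assoc u u y, huy.eq]; simp only [mul_assoc]
      _ = φ (u * (x * u) * y) := by rw [← h1]; simp only [mul_assoc]
  -- The same argument with `u` on the right face, starting from `φ (x * (u * y * u)) = 0`.
  · have h0 : φ (polyProd a ([] ++ [(k, p)]) * polyProd b ([(i, r), (k, q)] ++ [(i, r)])) = 0 := by
      refine hm.apply_polyProd_left_right (List.isChain_singleton _) ?_ ?_ ?_
        (fun hki => absurd hki h)
      · simp [Centered, hp]
      · simp [Alternating, h, h.symm]
      · simp [Centered, hr, hq]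
    refine (mul_eq_zero.1 ?_).resolve_left hrr
    rw [← map_mul (Polynomial.aeval (b i)), ← hm.apply_right_mul h, ← h0]
    set u := Polynomial.aeval (b i) r with hu
    set x := Polynomial.aeval (a k) p with hx
    set y := Polynomial.aeval (b k) q with hy
    have hxu : Commute x u := commute_aeval (hcomm k i) p r
    have h1 := htr u (hB i r) (u * (x * y)) (mul_mem (hB i r) (mul_mem (hA k p) (hB k q)))
    simp only [List.cons_append, List.nil_append, polyProd_cons, polyProd_nil, mul_one, map_mul,
      ← hu, ← hx, ← hy]
    rw [mul_assoc, h1, ← mul_assoc u x, ← hxu.eq]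
    simp only [mul_assoc]

/-- By linearity it suffices to treat alternating centered words. If one of them is empty the claim
is trivial; otherwise both sides vanish, and `h` covers the case where the last factors share an
index. -/
theorem HasModel.apply_mul (hm : HasModel φ a b T S) (hφ : φ 1 = 1)
    (h : ∀ (k : Fin 2) (p q : Polynomial ℂ), φ (Polynomial.aeval (a k) p) = 0 →
      φ (Polynomial.aeval (b k) q) = 0 →
      φ (Polynomial.aeval (a k) p * Polynomial.aeval (b k) q) = 0)
    {x y : A} (hx : x ∈ Algebra.adjoin ℂ (Set.range a)) (hy : y ∈ Algebra.adjoin ℂ (Set.range b)) :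
    φ (x * y) = φ x * φ y := by
  replace hx := mem_span_polyProd hφ a hx
  replace hy := mem_span_polyProd hφ b hy
  induction hx using Submodule.span_induction with
  | zero => simp
  | add x x' _ _ hx hx' => simp [add_mul, hx, hx']
  | smul c x _ hx => simp [hx, mul_assoc]
  | mem x hx =>
    obtain ⟨l, hl, hlc, rfl⟩ := hx
    induction hy using Submodule.span_induction with
    | zero => simp
    | add y y' _ _ hy hy' => simp [mul_add, hy, hy']
    | smul c y _ hy => simp [hy, mul_left_comm]
    | mem y hy =>
      obtain ⟨r, hr, hrc, rfl⟩ := hy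
      rcases List.eq_nil_or_concat l with rfl | ⟨l, s, rfl⟩
      · simp [hφ]
      rcases List.eq_nil_or_concat r with rfl | ⟨r, t, rfl⟩
      · simp [hφ]
      rw [List.concat_eq_append] at hl hlc hr hrc ⊢
      rw [List.concat_eq_append]
      rw [hm.apply_polyProd_left hl hlc (by simp), zero_mul]
      refine hm.apply_polyProd_left_right hl hlc hr hrc fun hts => h _ _ _ (hlc s (by simp)) ?_
      rw [← hts]
      exact hrc t (by simp)

theorem commute_of_mem_adjoin (hcomm : ∀ i j, Commute (a i) (b j)) {x y : A}
    (hx : x ∈ Algebra.adjoin ℂ (Set.range a)) (hy : y ∈ Algebra.adjoin ℂ (Set.range b)) :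
    Commute x y := by
  refine (Algebra.commute_of_mem_adjoin_of_forall_mem_commute hx ?_).symm
  rintro _ ⟨i, rfl⟩
  refine (Algebra.commute_of_mem_adjoin_of_forall_mem_commute hy ?_).symm
  rintro _ ⟨j, rfl⟩
  exact hcomm i j

end Independence

end BiFree

/-! ### From classical independence to the tensor product -/

section TensorProduct

variable {A : Type*} [Ring A] [Algebra ℂ A]

theorem exists_mulHom_of_classicallyIndependent {φ : A →ₗ[ℂ] ℂ} {S R W : Subalgebra ℂ A}
    (h : ClassicallyIndependent φ S R) (hS : S ≤ W) (hR : R ≤ W) :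
    ∃ f : S ⊗[ℂ] R →ₐ[ℂ] W, ∀ x y, (f (x ⊗ₜ[ℂ] y) : A) = (x : A) * (y : A) :=
  ⟨Algebra.TensorProduct.lift (Subalgebra.inclusion hS) (Subalgebra.inclusion hR)
    fun x y => Subtype.ext (h x x.2 y y.2).1,
    fun x y => congrArg Subtype.val (Algebra.TensorProduct.lift_tmul _ _ _ x y)⟩

/-- Applying `φ (x * (y * ·))` to the relation gives `φ (y * ∑ φ (x * c i) • B i) = 0` for all `y ∈
R`. Nondegeneracy on `R`, linear independence of `B` and nondegeneracy on `S` then give `c i = 0`,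
in this order. -/
theorem eq_zero_of_sum_mul_eq_zero {φ : A →ₗ[ℂ] ℂ} {S R : Subalgebra ℂ A}
    (h : ClassicallyIndependent φ S R)
    (hs : ∀ x ∈ S, (∀ z ∈ S, φ (z * x) = 0) → x = 0)
    (ht : ∀ x ∈ R, (∀ z ∈ R, φ (z * x) = 0) → x = 0)
    {ι : Type*} {B : ι → A} (hBR : ∀ i, B i ∈ R) (hB : LinearIndependent ℂ B)
    {I : Finset ι} {c : ι → A} (hc : ∀ i, c i ∈ S) (h0 : ∑ i ∈ I, c i * B i = 0) :
    ∀ i ∈ I, c i = 0 := by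
  intro i hi
  refine hs _ (hc i) fun x hx => ?_
  refine linearIndependent_iff'.1 hB I (fun i => φ (x * c i)) ?_ i hi
  refine ht _ (sum_mem fun i _ => Subalgebra.smul_mem _ (hBR i) _) fun y hy => ?_
  have h1 := congrArg (fun w => φ (x * (y * w))) h0
  simp only [mul_zero, map_zero, Finset.mul_sum, map_sum] at h1
  rw [← h1]
  simp only [Finset.mul_sum, map_sum, mul_smul_comm, map_smul, smul_eq_mul]
  refine Finset.sum_congr rfl fun i _ => ?_
  rw [← (h _ (mul_mem hx (hc i)) _ (mul_mem hy (hBR i))).2, ← mul_assoc y,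
    ← (h _ (hc i) y hy).1.eq]
  simp only [mul_assoc]

theorem injective_of_classicallyIndependent {φ : A →ₗ[ℂ] ℂ} {S R W : Subalgebra ℂ A}
    (h : ClassicallyIndependent φ S R)
    (hs : ∀ x ∈ S, (∀ z ∈ S, φ (z * x) = 0) → x = 0)
    (ht : ∀ x ∈ R, (∀ z ∈ R, φ (z * x) = 0) → x = 0)
    {f : S ⊗[ℂ] R →ₐ[ℂ] W} (hf : ∀ x y, (f (x ⊗ₜ[ℂ] y) : A) = (x : A) * (y : A)) :
    Function.Injective f := by
  rw [injective_iff_map_eq_zero]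
  intro z hz
  -- Over a basis of `R` a tensor is a unique finite sum `∑ c i ⊗ B i`, so it vanishes once its
  -- coefficients do.
  let B := Module.Free.chooseBasis ℂ R
  obtain ⟨c, rfl⟩ := (TensorProduct.equivFinsuppOfBasisRight B).symm.surjective z
  have h0 : ∑ i ∈ c.support, ((c i : S) : A) * ((B i : R) : A) = 0 := by
    have := congrArg Subtype.val hz
    rw [TensorProduct.equivFinsuppOfBasisRight_symm_apply, Finsupp.sum, map_sum,
      AddSubmonoidClass.coe_finsetSum, ZeroMemClass.coe_zero] at this
    rw [← this]
    exact Finset.sum_congr rfl fun i _ => (hf _ _).symm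
  have hB : LinearIndependent ℂ fun i => ((B i : R) : A) :=
    B.linearIndependent.map' R.val.toLinearMap (LinearMap.ker_eq_bot.2 Subtype.val_injective)
  have key := eq_zero_of_sum_mul_eq_zero h hs ht (fun i => (B i).2) hB (fun i => (c i).2) h0
  have hc : c = 0 := by
    ext i
    by_contra hne
    exact hne (key i (Finsupp.mem_support_iff.2 fun h => hne (by rw [h]; rfl)))
  rw [hc, map_zero]

theorem exists_tensorEquiv_of_classicallyIndependent {φ : A →ₗ[ℂ] ℂ} {S R W : Subalgebra ℂ A}
    (h : ClassicallyIndependent φ S R) (hS : S ≤ W) (hR : R ≤ W) (hW : W ≤ S ⊔ R)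
    (hs : ∀ x ∈ S, (∀ z ∈ S, φ (z * x) = 0) → x = 0)
    (ht : ∀ x ∈ R, (∀ z ∈ R, φ (z * x) = 0) → x = 0) :
    ∃ e : (S ⊗[ℂ] R) ≃ₐ[ℂ] W, (∀ x y, (e (x ⊗ₜ[ℂ] y) : A) = (x : A) * (y : A)) ∧
      ∀ z, φ (e z : A) =
        TensorProduct.lid ℂ ℂ (TensorProduct.map (restrictTo φ S) (restrictTo φ R) z) := by
  obtain ⟨f, hf⟩ := exists_mulHom_of_classicallyIndependent h hS hR
  have hsurj : Function.Surjective f := by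
    have : W ≤ (W.val.comp f).range := by
      refine hW.trans (sup_le (fun x hx => ?_) fun x hx => ?_)
      · exact ⟨(⟨x, hx⟩ : S) ⊗ₜ 1, (hf _ _).trans (mul_one x)⟩
      · exact ⟨1 ⊗ₜ (⟨x, hx⟩ : R), (hf _ _).trans (one_mul x)⟩
    intro x
    obtain ⟨z, hz⟩ := this x.2
    exact ⟨z, Subtype.ext hz⟩
  obtain ⟨e, he⟩ : ∃ e : (S ⊗[ℂ] R) ≃ₐ[ℂ] W, ∀ z, e z = f z :=
    ⟨AlgEquiv.ofBijective f ⟨injective_of_classicallyIndependent h hs ht hf, hsurj⟩,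
      AlgEquiv.ofBijective_apply f _⟩
  refine ⟨e, fun x y => by rw [he, hf], fun z => ?_⟩
  induction z using TensorProduct.induction_on with
  | zero => simp only [map_zero, ZeroMemClass.coe_zero]
  | add x y hx hy => rw [map_add, Subalgebra.coe_add, map_add, hx, hy, map_add, map_add]
  | tmul x y =>
    rw [he, hf, (h x x.2 y y.2).2, TensorProduct.map_tmul, TensorProduct.lid_tmul, smul_eq_mul]
    rfl

variable [StarRing A] [StarModule ℂ A]

theorem IsStarProbSpace.isTracialState_restrictTo {φ : A →ₗ[ℂ] ℂ} (hφ : IsStarProbSpace φ)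
    {S R : Subalgebra ℂ A} (hSR : S ≤ R) (htr : IsTracialOn φ R) :
    IsTracialState S (restrictTo φ S) where
  map_one := hφ.map_one
  nonneg x z hz := by
    change 0 ≤ (φ (z : A)).re ∧ (φ (z : A)).im = 0
    rw [hz]
    exact hφ.nonneg x
  tracial x y := htr x (hSR x.2) y (hSR y.2)

end TensorProduct

/-! ### The main theorem -/

theorem mainTheorem4 {A : Type*} [Ring A] [Algebra ℂ A] [StarRing A] [StarModule ℂ A]
    (φ : A →ₗ[ℂ] ℂ) (hφ : IsStarProbSpace φ)
    (a b : Fin 2 → A)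
    (ha : ∀ k, IsSelfAdjoint (a k)) (hb : ∀ k, IsSelfAdjoint (b k))
    (hfree : IsBiFree φ a b)
    (htr : IsTracialOn φ (Algebra.adjoin ℂ (Set.range a ∪ Set.range b)))
    (hns : ∀ k, ¬ ∃ α β : ℝ, ∀ n : ℕ, φ (a k ^ n) = (α : ℂ) ^ n ∧ φ (b k ^ n) = (β : ℂ) ^ n) :
    ClassicallyIndependent φ (Algebra.adjoin ℂ (Set.range a)) (Algebra.adjoin ℂ (Set.range b)) ∧
    IsTracialState (Algebra.adjoin ℂ (Set.range a))
      (restrictTo φ (Algebra.adjoin ℂ (Set.range a))) ∧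
    IsTracialState (Algebra.adjoin ℂ (Set.range b))
      (restrictTo φ (Algebra.adjoin ℂ (Set.range b))) ∧
    ∃ e : (Algebra.adjoin ℂ (Set.range a) ⊗[ℂ] Algebra.adjoin ℂ (Set.range b)) ≃ₐ[ℂ]
        Algebra.adjoin ℂ (Set.range a ∪ Set.range b),
      (∀ x y, (e (x ⊗ₜ[ℂ] y) : A) = (x : A) * (y : A)) ∧
      ∀ t, φ (e t : A) =
        TensorProduct.lid ℂ ℂ (TensorProduct.map
          (restrictTo φ (Algebra.adjoin ℂ (Set.range a)))
          (restrictTo φ (Algebra.adjoin ℂ (Set.range b))) t) := by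
  obtain ⟨P, T, S, hm⟩ := hfree
  have hm : BiFree.HasModel φ a b T S := hm
  have hv : ∀ k, BiFree.HasVariance φ (a k) ∨ BiFree.HasVariance φ (b k) := by
    intro k
    by_contra! h
    obtain ⟨α, hα⟩ := BiFree.pow_eq_of_not_hasVariance hφ (ha k) h.1
    obtain ⟨β, hβ⟩ := BiFree.pow_eq_of_not_hasVariance hφ (hb k) h.2
    exact hns k ⟨α, β, fun n => ⟨hα n, hβ n⟩⟩
  -- The commutation and factorization within pair `k` use the variance of the other pair, so both
  -- pairs have to be nonscalar.
  have hother : ∀ k : Fin 2, ∃ i, i ≠ k := exists_ne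
  have hcomm : ∀ i j, Commute (a i) (b j) := by
    intro i j
    by_cases h : i = j
    · subst h
      obtain ⟨k, hk⟩ := hother i
      exact hm.commute_same hφ ha hb hk (hv k)
    · exact hm.commute_of_ne hφ ha hb h
  have hind : ClassicallyIndependent φ (Algebra.adjoin ℂ (Set.range a))
      (Algebra.adjoin ℂ (Set.range b)) := fun x hx y hy =>
    ⟨BiFree.commute_of_mem_adjoin hcomm hx hy, hm.apply_mul hφ.map_one (fun k p q hp hq => by
      obtain ⟨i, hi⟩ := hother k
      exact hm.apply_mul_eq_zero hcomm htr hi (hv i) hp hq) hx hy⟩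
  -- Nondegeneracy comes from testing with `z = star x`, which stays in the algebra because its
  -- generators are self-adjoint.
  have hnd : ∀ c : Fin 2 → A, (∀ k, IsSelfAdjoint (c k)) →
      ∀ x ∈ Algebra.adjoin ℂ (Set.range c),
        (∀ z ∈ Algebra.adjoin ℂ (Set.range c), φ (z * x) = 0) → x = 0 := fun c hc x hx h =>
    hφ.faithful x (h _ (BiFree.star_mem_adjoin (by rintro _ ⟨k, rfl⟩; exact hc k) hx))
  exact ⟨hind,
    hφ.isTracialState_restrictTo (Algebra.adjoin_mono Set.subset_union_left) htr,
    hφ.isTracialState_restrictTo (Algebra.adjoin_mono Set.subset_union_right) htr,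
    exists_tensorEquiv_of_classicallyIndependent hind (Algebra.adjoin_mono Set.subset_union_left)
      (Algebra.adjoin_mono Set.subset_union_right) (Algebra.adjoin_union _ _).le
      (hnd a ha) (hnd b hb)⟩
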